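/- Let $L$ be a finite lattice with a fixed planar diagram: its elements are drawn as distinct points of the plane, each covering $a\prec b$ is drawn as a straight segment going up from $a$ to $b$, no edge passes through the point of a third element, and distinct edges meet at most in a common endpoint. Assume that $L$ is generated by its atoms, as the sublattice generated by $0$ and all the atoms, and let $n$ be the number of atoms of $L$. (If $n\ge 2$, the atoms alone then generate $L$, since $0$ is the meet of two atoms.) For a maximal chain $C$ of $L$, an element $x$ is on or to the left (right) of $C$ if, at the height of $x$, the polygonal line drawn by $C$ passes through $x$ or to the right (left) of $x$. For incomparable $x,y$, $x$ is to the left of $y$ if $x$ is on the left of some maximal chain containing $y$. The left (right) boundary of $L$ is the set of the elements that are on or to the left (right) of every maximal chain of $L$. (1) Let $a_1,\dots,a_n$ be all the atoms of $L$ listed from left to right, that is, $a_i$ is to the left of $a_j$ whenever $i<j$, and put $c_k=a_1\vee a_k$ for $k=1,\dots,n$ (so $c_1=a_1$). Then $c_k=a_1\vee a_2\vee\dots\vee a_k$ for all $k$; if $n\ge 1$, then $0<c_1\le c_2\le\dots\le c_n=1$; and $\{0,c_1,\dots,c_n\}$ is a maximal chain of $L$ and is the left boundary of $L$. (2) Both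 the left boundary and the right boundary of $L$ have at most $n+1$ elements. -/

import Mathlib

/-- A planar (Hasse) diagram of an order `L`: the elements are drawn as distinct points of the
plane, every covering `a ⋖ b` is drawn as the straight segment from `pt a` up to `pt b`, no edge
passes through the point of a third element, and two distinct edges can meet only in a common
endpoint. -/
structure PlanarDiagram (L : Type*) [PartialOrder L] where
  /-- The point of the plane that represents an element. -/
  pt : L → ℝ × ℝ
  pt_injective : Function.Injective pt
  height_lt : ∀ a b : L, a ⋖ b → (pt a).2 < (pt b).2
  pt_notMem_edge : ∀ a b c : L, a ⋖ b → pt c ∉ openSegment ℝ (pt a) (pt b)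
  edges_disjoint : ∀ a b c d : L, a ⋖ b → c ⋖ d → (a, b) ≠ (c, d) →
    Disjoint (openSegment ℝ (pt a) (pt b)) (openSegment ℝ (pt c) (pt d))

namespace PlanarDiagram

variable {L : Type*} [PartialOrder L] (D : PlanarDiagram L)

/-- The polygonal line drawn by a maximal chain `C`: its vertices (`a = b`) and the edges
between its consecutive elements (`a ⋖ b`). -/
def chainPath (C : Set L) : Set (ℝ × ℝ) :=
  {p | ∃ a ∈ C, ∃ b ∈ C, a ⩿ b ∧ p ∈ segment ℝ (D.pt a) (D.pt b)}

/-- `x` is on or to the left of the maximal chain `C`: at the height of `x`, the polygonal line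
of `C` passes through `x` or to the right of `x`. -/
def OnOrLeftOfChain (x : L) (C : Set L) : Prop :=
  ∃ p ∈ D.chainPath C, p.2 = (D.pt x).2 ∧ (D.pt x).1 ≤ p.1

/-- `x` is on or to the right of the maximal chain `C`. -/
def OnOrRightOfChain (x : L) (C : Set L) : Prop :=
  ∃ p ∈ D.chainPath C, p.2 = (D.pt x).2 ∧ p.1 ≤ (D.pt x).1

/-- `x` is to the left of `y`: they are incomparable, and `x` lies on the left side of some
maximal chain through `y`. As `x` is incomparable with `y`, it is not an element of that chain,
so it is strictly on the left of it. -/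
def LeftOf (x y : L) : Prop :=
  ¬ x ≤ y ∧ ¬ y ≤ x ∧ ∃ C : Set L, IsMaxChain (· ≤ ·) C ∧ y ∈ C ∧ D.OnOrLeftOfChain x C

/-- The left boundary of the diagram: the elements that are on or to the left of every maximal
chain. -/
def leftBoundary : Set L :=
  {x | ∀ C : Set L, IsMaxChain (· ≤ ·) C → D.OnOrLeftOfChain x C}

/-- The right boundary of the diagram: the elements that are on or to the right of every maximal
chain. -/
def rightBoundary : Set L :=
  {x | ∀ C : Set L, IsMaxChain (· ≤ ·) C → D.OnOrRightOfChain x C}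

end PlanarDiagram

/-- For a list `a₁, …, aₙ` of elements, the elements `c₁ = a₁` (`= a₁ ⊔ a₁`), `c₂ = a₁ ⊔ a₂`,
…, `cₙ = a₁ ⊔ aₙ`. (The list is indexed from `0` here.) -/
def leftChainElement {L : Type*} [Lattice L] {n : ℕ} (a : Fin n → L) (k : Fin n) : L :=
  a ⟨0, k.pos⟩ ⊔ a k

/-!
The proof separates the plane geometry from the lattice theory.

**Geometry.** The points on or to the left of the polygonal line of a maximal chain `C` form a
closed set `leftSide C`, and similarly for `rightSide C`. Together they cover the strip between the
heights of `⊥` and `⊤`, and they meet exactly in the line. As an open edge that is not part of the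
line does not meet it, connectedness puts every edge on one side (`edge_subset_side`). Hence an
ascending path that changes sides passes through an element of `C`
(`exists_mem_between_of_mem_sides`).

For atoms, being to the left means having the smaller inverse slope of the edge from `⊥`
(`atom_side`). A maximal chain through the middle one of three atoms separates the outer two, so
an upper bound of the outer two is above the middle one, too (`atom_le_of_invSlope_between`): the
atoms below an element form an interval.

**Lattice theory.** Let `a₁, …, aₙ` be the atoms from left to right and `cₖ = a₁ ⊔ aₖ`. The elements
`y` with the property that `y ≤ cₖ` if all atoms below `y` are among `a₁, …, aₖ` form a sublattice,
because the atoms below an element form an interval. It contains `⊥` and the atoms, so it is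
everything (`le_leftChainElement`). If `y ≥ a₁` and `k` is the greatest index with `aₖ ≤ y`, it
follows that `y = cₖ`. Thus the elements above `a₁` are `c₁ ≤ … ≤ cₙ = ⊤`, and these form a maximal
chain with `⊥`.

An ascending path from an atom to an element strictly on the left of this chain would meet the
chain in an element above `a₁`, and then end in the chain. So everything is on or to the right of
this chain, which makes it the left boundary (`leftBoundary_eq_leftChain`). The bound for the right
boundary is that for the left boundary of the mirror image of the diagram.
-/

namespace PlanarDiagram

/-! ### The two sides of a maximal chain -/

section Sides

variable {L : Type*} [PartialOrder L] (D : PlanarDiagram L)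

/-- The points of the plane that are on the polygonal line of `C` or to the left of it. -/
def leftSide (C : Set L) : Set (ℝ × ℝ) :=
  {z | ∃ p ∈ D.chainPath C, p.2 = z.2 ∧ z.1 ≤ p.1}

/-- The points of the plane that are on the polygonal line of `C` or to the right of it. -/
def rightSide (C : Set L) : Set (ℝ × ℝ) :=
  {z | ∃ p ∈ D.chainPath C, p.2 = z.2 ∧ p.1 ≤ z.1}

theorem chainPath_subset_leftSide (C : Set L) : D.chainPath C ⊆ D.leftSide C :=
  fun z hz => ⟨z, hz, rfl, le_rfl⟩

theorem chainPath_subset_rightSide (C : Set L) : D.chainPath C ⊆ D.rightSide C :=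
  fun z hz => ⟨z, hz, rfl, le_rfl⟩

theorem pt_mem_chainPath {C : Set L} {x : L} (hx : x ∈ C) : D.pt x ∈ D.chainPath C :=
  ⟨x, hx, x, hx, WCovBy.refl x, left_mem_segment ℝ _ _⟩

theorem mem_of_pt_mem_chainPath {C : Set L} {x : L} (h : D.pt x ∈ D.chainPath C) : x ∈ C := by
  obtain ⟨a, ha, b, hb, hab, hx⟩ := h
  rw [← insert_endpoints_openSegment] at hx
  rcases hx with hx | hx | hx
  · rwa [D.pt_injective hx]
  · rwa [D.pt_injective hx]
  · rcases hab.covBy_or_eq with hab | rfl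
    · exact absurd hx (D.pt_notMem_edge a b x hab)
    · rw [openSegment_same] at hx
      rwa [D.pt_injective hx]

theorem isCompact_chainPath [Finite L] (C : Set L) : IsCompact (D.chainPath C) := by
  have h : D.chainPath C =
      ⋃ q ∈ {q : L × L | q.1 ∈ C ∧ q.2 ∈ C ∧ q.1 ⩿ q.2}, segment ℝ (D.pt q.1) (D.pt q.2) := by
    ext z
    simp only [chainPath, Set.mem_ofPred_eq, Set.mem_iUnion, Prod.exists, exists_prop]
    constructor
    · rintro ⟨a, ha, b, hb, hab, hz⟩
      exact ⟨a, b, ⟨ha, hb, hab⟩, hz⟩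
    · rintro ⟨a, b, ⟨ha, hb, hab⟩, hz⟩
      exact ⟨a, ha, b, hb, hab, hz⟩
  rw [h]
  refine (Set.toFinite _).isCompact_biUnion fun q _ => ?_
  rw [segment_eq_image]
  exact isCompact_Icc.image (by fun_prop)

open scoped Pointwise in
theorem isClosed_leftSide [Finite L] (C : Set L) : IsClosed (D.leftSide C) := by
  have h : D.leftSide C = D.chainPath C + {z : ℝ × ℝ | z.2 = 0 ∧ z.1 ≤ 0} := by
    ext z
    rw [Set.mem_add]
    constructor
    · rintro ⟨p, hp, h2, h1⟩
      exact ⟨p, hp, z - p, by simp [h2, h1], by simp⟩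
    · rintro ⟨p, hp, w, ⟨hw2, hw1⟩, rfl⟩
      exact ⟨p, hp, by simp [hw2], by simpa using hw1⟩
  rw [h]
  refine IsClosed.add_left_of_isCompact ?_ (D.isCompact_chainPath C)
  exact (isClosed_eq continuous_snd continuous_const).inter
    (isClosed_le continuous_fst continuous_const)

open scoped Pointwise in
theorem isClosed_rightSide [Finite L] (C : Set L) : IsClosed (D.rightSide C) := by
  have h : D.rightSide C = D.chainPath C + {z : ℝ × ℝ | z.2 = 0 ∧ 0 ≤ z.1} := by
    ext z
    rw [Set.mem_add]
    constructor
    · rintro ⟨p, hp, h2, h1⟩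
      exact ⟨p, hp, z - p, by simp [h2, h1], by simp⟩
    · rintro ⟨p, hp, w, ⟨hw2, hw1⟩, rfl⟩
      exact ⟨p, hp, by simp [hw2], by simpa using hw1⟩
  rw [h]
  refine IsClosed.add_left_of_isCompact ?_ (D.isCompact_chainPath C)
  exact (isClosed_eq continuous_snd continuous_const).inter
    (isClosed_le continuous_const continuous_fst)

end Sides

/-! ### Segments and heights -/

/-- A non-horizontal segment has a point at every intermediate height. -/
theorem exists_mem_segment_snd_eq {p q : ℝ × ℝ} {h : ℝ} (hpq : p.2 < q.2) (hp : p.2 ≤ h)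
    (hq : h ≤ q.2) : ∃ z ∈ segment ℝ p q, z.2 = h := by
  have hd : 0 < q.2 - p.2 := sub_pos.2 hpq
  refine ⟨AffineMap.lineMap p q ((h - p.2) / (q.2 - p.2)), ?_, ?_⟩
  · rw [segment_eq_image_lineMap]
    exact ⟨_, ⟨div_nonneg (by linarith) hd.le, (div_le_one hd).2 (by linarith)⟩, rfl⟩
  · simp only [AffineMap.lineMap_apply, vsub_eq_sub, vadd_eq_add, Prod.snd_add, Prod.smul_snd,
      Prod.snd_sub, smul_eq_mul]
    field_simp
    ring

/-- The points of a non-horizontal segment in terms of the inverse slope of the segment. -/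
theorem fst_eq_of_mem_segment {p q z : ℝ × ℝ} (hpq : p.2 < q.2) (hz : z ∈ segment ℝ p q) :
    z.1 = p.1 + (q.1 - p.1) / (q.2 - p.2) * (z.2 - p.2) := by
  have hd : q.2 - p.2 ≠ 0 := (sub_pos.2 hpq).ne'
  rw [segment_eq_image_lineMap] at hz
  obtain ⟨t, -, rfl⟩ := hz
  simp only [AffineMap.lineMap_apply, vsub_eq_sub, vadd_eq_add, Prod.snd_add, Prod.smul_snd,
    Prod.snd_sub, smul_eq_mul, Prod.fst_add, Prod.smul_fst, Prod.fst_sub]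
  field_simp
  ring

theorem snd_mem_Icc_of_mem_segment {p q z : ℝ × ℝ} (hpq : p.2 ≤ q.2) (hz : z ∈ segment ℝ p q) :
    z.2 ∈ Set.Icc p.2 q.2 := by
  rw [segment_eq_image_lineMap] at hz
  obtain ⟨t, ⟨h0, h1⟩, rfl⟩ := hz
  simp only [AffineMap.lineMap_apply, vsub_eq_sub, vadd_eq_add, Prod.snd_add, Prod.smul_snd,
    Prod.snd_sub, smul_eq_mul, Set.mem_Icc]
  constructor <;> nlinarith

theorem segment_snd_injOn {p q : ℝ × ℝ} (hpq : p.2 < q.2) :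
    Set.InjOn Prod.snd (segment ℝ p q) := by
  intro z hz w hw h
  have hz' := fst_eq_of_mem_segment hpq hz
  have hw' := fst_eq_of_mem_segment hpq hw
  rw [h] at hz'
  exact Prod.ext (hz'.trans hw'.symm) h

/-! ### The polygonal line of a maximal chain -/

section Chains

variable {L : Type*} [PartialOrder L] [Finite L] (D : PlanarDiagram L)

theorem height_strictMono : StrictMono fun x => (D.pt x).2 := by
  classical
  have := Fintype.ofFinite L
  let _ : LocallyFiniteOrder L := LocallyFiniteOrder.ofFiniteIcc fun a b => Set.toFinite _
  exact strictMono_iff_forall_covBy _ |>.2 fun a b h => D.height_lt a b h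

variable {D}

theorem height_mem_Icc {a b : L} (hab : a ≤ b) {z : ℝ × ℝ}
    (hz : z ∈ segment ℝ (D.pt a) (D.pt b)) : z.2 ∈ Set.Icc (D.pt a).2 (D.pt b).2 :=
  snd_mem_Icc_of_mem_segment (D.height_strictMono.monotone hab) hz

theorem edge_height_injOn {a b : L} (hab : a ≤ b) :
    Set.InjOn Prod.snd (segment ℝ (D.pt a) (D.pt b)) := by
  rcases hab.eq_or_lt with rfl | hab
  · rw [segment_same]
    exact Set.injOn_singleton _ _
  · exact segment_snd_injOn (D.height_strictMono hab)

/-- The pieces of a polygonal line lie one above the other, hence the height determines the point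
of the line. -/
theorem chainPath_height_injOn {C : Set L} (hC : IsChain (· ≤ ·) C) :
    Set.InjOn Prod.snd (D.chainPath C) := by
  -- If one piece ends below the beginning of the other, then the two meet in a vertex.
  have key : ∀ a b c d : L, a ≤ b → c ≤ d → b ≤ c → ∀ z ∈ segment ℝ (D.pt a) (D.pt b),
      ∀ w ∈ segment ℝ (D.pt c) (D.pt d), z.2 = w.2 → z = w := by
    intro a b c d hab hcd hbc z hz w hw h
    have h1 := (height_mem_Icc hab hz).2
    have h2 := (height_mem_Icc hcd hw).1
    have h3 : (D.pt b).2 ≤ (D.pt c).2 := D.height_strictMono.monotone hbc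
    have h4 : b = c := by
      by_contra hne
      have : (D.pt b).2 < (D.pt c).2 := D.height_strictMono (lt_of_le_of_ne hbc hne)
      linarith
    subst h4
    have hz' := edge_height_injOn hab hz (right_mem_segment ℝ _ _) (by linarith : z.2 = (D.pt b).2)
    have hw' := edge_height_injOn hcd hw (left_mem_segment ℝ _ _) (by linarith : w.2 = (D.pt b).2)
    rw [hz', hw']
  rintro z ⟨a, ha, b, hb, hab, hz⟩ w ⟨c, hc, d, hd, hcd, hw⟩ h
  by_cases hbc : b ≤ c
  · exact key a b c d hab.le hcd.le hbc z hz w hw h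
  by_cases hda : d ≤ a
  · exact (key c d a b hcd.le hab.le hda w hw z hz h.symm).symm
  have hcb : c < b := lt_of_le_not_ge ((hC.total hb hc).resolve_left hbc) hbc
  have had : a < d := lt_of_le_not_ge ((hC.total hd ha).resolve_left hda) hda
  have hac : a = c := by
    rcases hC.total ha hc with hle | hle
    · by_contra hne
      exact hab.2 (lt_of_le_of_ne hle hne) hcb
    · by_contra hne
      exact hcd.2 (lt_of_le_of_ne hle (Ne.symm hne)) had
  subst hac
  have hbd : b = d := by
    rcases hC.total hb hd with hle | hle
    · by_contra hne
      exact hcd.2 hcb (lt_of_le_of_ne hle hne)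
    · by_contra hne
      exact hab.2 had (lt_of_le_of_ne hle (Ne.symm hne))
  subst hbd
  exact edge_height_injOn hab.le hz hw h

theorem mem_chainPath_of_mem_sides {C : Set L} (hC : IsChain (· ≤ ·) C) {z : ℝ × ℝ}
    (hl : z ∈ D.leftSide C) (hr : z ∈ D.rightSide C) : z ∈ D.chainPath C := by
  obtain ⟨p, hp, hp2, hp1⟩ := hl
  obtain ⟨q, hq, hq2, hq1⟩ := hr
  have hpq : p = q := chainPath_height_injOn hC hp hq (hp2.trans hq2.symm)
  subst hpq
  rwa [Prod.ext (le_antisymm hp1 hq1) hp2.symm]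

theorem mem_of_pt_mem_sides {C : Set L} (hC : IsChain (· ≤ ·) C) {x : L}
    (hl : D.pt x ∈ D.leftSide C) (hr : D.pt x ∈ D.rightSide C) : x ∈ C :=
  D.mem_of_pt_mem_chainPath (mem_chainPath_of_mem_sides hC hl hr)

variable [BoundedOrder L]

theorem exists_mem_chainPath {C : Set L} (hC : IsMaxChain (· ≤ ·) C) {h : ℝ}
    (h0 : (D.pt ⊥).2 ≤ h) (h1 : h ≤ (D.pt ⊤).2) : ∃ p ∈ D.chainPath C, p.2 = h := by
  obtain ⟨a, ⟨haC, hah⟩, hamax⟩ := Set.Finite.exists_maximal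
    (s := {x | x ∈ C ∧ (D.pt x).2 ≤ h}) (Set.toFinite _) ⟨⊥, hC.bot_mem, h0⟩
  rcases hah.eq_or_lt with heq | hlt
  · exact ⟨D.pt a, D.pt_mem_chainPath haC, heq⟩
  have htop : ⊤ ∈ {x | x ∈ C ∧ h < (D.pt x).2} := by
    refine ⟨hC.top_mem, lt_of_le_of_ne h1 fun he => ?_⟩
    have := hamax ⟨hC.top_mem, he.ge⟩ le_top
    have : a = ⊤ := top_le_iff.1 this
    subst this
    exact hlt.ne he.symm
  obtain ⟨b, ⟨hbC, hbh⟩, hbmin⟩ := Set.Finite.exists_minimal (Set.toFinite _) ⟨⊤, htop⟩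
  have hab : a < b := by
    rcases hC.1.total haC hbC with hle | hle
    · exact lt_of_le_of_ne hle fun he => by subst he; linarith
    · have : (D.pt b).2 ≤ (D.pt a).2 := D.height_strictMono.monotone hle
      linarith
  -- An element `z` strictly between `a` and `b` would be comparable to all elements of `C`.
  have hcov : a ⩿ b := by
    refine ⟨hab.le, fun z haz hzb => ?_⟩
    have hz : IsChain (· ≤ ·) (insert z C) := by
      refine hC.1.insert fun c hc _ => ?_
      by_cases hch : (D.pt c).2 ≤ h
      · rcases hC.1.total haC hc with hle | hle
        · exact Or.inr ((hamax ⟨hc, hch⟩ hle).trans haz.le)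
        · exact Or.inr (hle.trans haz.le)
      · rcases hC.1.total hbC hc with hle | hle
        · exact Or.inl (hzb.le.trans hle)
        · exact Or.inl (hzb.le.trans (hbmin ⟨hc, not_le.1 hch⟩ hle))
    have hzC : z ∈ C := by
      rw [hC.2 hz (Set.subset_insert _ _)]
      exact Set.mem_insert _ _
    by_cases hzh : (D.pt z).2 ≤ h
    · exact haz.not_ge (hamax ⟨hzC, hzh⟩ haz.le)
    · exact hzb.not_ge (hbmin ⟨hzC, not_le.1 hzh⟩ hzb.le)
  obtain ⟨p, hp, hph⟩ := exists_mem_segment_snd_eq (D.height_strictMono hab) hah hbh.le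
  exact ⟨p, ⟨a, haC, b, hbC, hcov, hp⟩, hph⟩

theorem mem_leftSide_or_mem_rightSide {C : Set L} (hC : IsMaxChain (· ≤ ·) C) {z : ℝ × ℝ}
    (h0 : (D.pt ⊥).2 ≤ z.2) (h1 : z.2 ≤ (D.pt ⊤).2) : z ∈ D.leftSide C ∨ z ∈ D.rightSide C := by
  obtain ⟨p, hp, hpz⟩ := exists_mem_chainPath hC h0 h1
  exact (le_total z.1 p.1).imp (fun h => ⟨p, hp, hpz, h⟩) fun h => ⟨p, hp, hpz, h⟩

theorem pt_mem_leftSide_or_mem_rightSide {C : Set L} (hC : IsMaxChain (· ≤ ·) C) (x : L) :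
    D.pt x ∈ D.leftSide C ∨ D.pt x ∈ D.rightSide C :=
  mem_leftSide_or_mem_rightSide hC (D.height_strictMono.monotone bot_le)
    (D.height_strictMono.monotone le_top)

/-- No edge crosses the polygonal line of a maximal chain: the open edge is connected, and off the
line the two sides are disjoint closed sets. -/
theorem edge_subset_side {C : Set L} (hC : IsMaxChain (· ≤ ·) C) {x y : L} (hxy : x ⋖ y) :
    segment ℝ (D.pt x) (D.pt y) ⊆ D.leftSide C ∨
      segment ℝ (D.pt x) (D.pt y) ⊆ D.rightSide C := by
  by_cases hin : x ∈ C ∧ y ∈ C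
  · exact Or.inl fun z hz =>
      D.chainPath_subset_leftSide C ⟨x, hin.1, y, hin.2, hxy.wcovBy, hz⟩
  have hdisj : ∀ z ∈ openSegment ℝ (D.pt x) (D.pt y), z ∉ D.chainPath C := by
    rintro z hz ⟨a, ha, b, hb, hab, hzab⟩
    rw [← insert_endpoints_openSegment] at hzab
    rcases hzab with rfl | rfl | hzab
    · exact D.pt_notMem_edge x y a hxy hz
    · exact D.pt_notMem_edge x y b hxy hz
    · rcases hab.covBy_or_eq with hab | rfl
      · refine Set.disjoint_left.1 (D.edges_disjoint x y a b hxy hab ?_) hz hzab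
        rintro h
        obtain ⟨rfl, rfl⟩ := Prod.mk.inj h
        exact hin ⟨ha, hb⟩
      · rw [openSegment_same] at hzab
        rw [Set.mem_singleton_iff.1 hzab] at hz
        exact D.pt_notMem_edge x y a hxy hz
  have hpre : IsPreconnected (openSegment ℝ (D.pt x) (D.pt y)) :=
    (convex_openSegment _ _).isPreconnected
  have hcover : openSegment ℝ (D.pt x) (D.pt y) ⊆ D.leftSide C ∪ D.rightSide C := by
    intro z hz
    obtain ⟨h0, h1⟩ := height_mem_Icc hxy.le (openSegment_subset_segment ℝ _ _ hz)
    exact mem_leftSide_or_mem_rightSide hC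
      ((D.height_strictMono.monotone (bot_le : ⊥ ≤ x)).trans h0)
      (h1.trans (D.height_strictMono.monotone (le_top : y ≤ ⊤)))
  have hl := D.isClosed_leftSide C
  have hr := D.isClosed_rightSide C
  rw [← closure_openSegment]
  refine (isPreconnected_iff_subset_of_disjoint_closed.1 hpre _ _ hl hr hcover ?_).imp
    (fun h => closure_minimal h hl) fun h => closure_minimal h hr
  refine Set.eq_empty_of_forall_notMem ?_
  rintro z ⟨hz, hzl, hzr⟩
  exact hdisj z hz (mem_chainPath_of_mem_sides hC.1 hzl hzr)

/-- An ascending path that changes the side of a maximal chain has an element in that chain. -/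
theorem exists_mem_between_of_mem_sides {C : Set L} (hC : IsMaxChain (· ≤ ·) C) {x y : L}
    (hxy : x ≤ y)
    (h : D.pt x ∈ D.leftSide C ∧ D.pt y ∈ D.rightSide C ∨
      D.pt x ∈ D.rightSide C ∧ D.pt y ∈ D.leftSide C) : ∃ z ∈ C, x ≤ z ∧ z ≤ y := by
  classical
  have := Fintype.ofFinite L
  let _ : LocallyFiniteOrder L := LocallyFiniteOrder.ofFiniteIcc fun a b => Set.toFinite _
  have hpath := le_iff_reflTransGen_covBy.1 hxy
  induction hpath with
  | refl =>
    refine ⟨x, ?_, le_rfl, le_rfl⟩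
    rcases h with h | h
    · exact mem_of_pt_mem_sides hC.1 h.1 h.2
    · exact mem_of_pt_mem_sides hC.1 h.2 h.1
  | @tail b c hxb hbc ih =>
    have hxb' : x ≤ b := le_iff_reflTransGen_covBy.2 hxb
    by_cases hc : c ∈ C
    · exact ⟨c, hc, hxy, le_rfl⟩
    suffices hb : D.pt x ∈ D.leftSide C ∧ D.pt b ∈ D.rightSide C ∨
        D.pt x ∈ D.rightSide C ∧ D.pt b ∈ D.leftSide C by
      obtain ⟨z, hz, hxz, hzb⟩ := ih hxb' hb
      exact ⟨z, hz, hxz, hzb.trans hbc.le⟩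
    rcases edge_subset_side (D := D) hC hbc with hs | hs
    · have hcl := hs (right_mem_segment ℝ _ _)
      have hcr : D.pt c ∉ D.rightSide C := fun hcr => hc (mem_of_pt_mem_sides hC.1 hcl hcr)
      exact Or.inr ⟨(h.resolve_left fun h => hcr h.2).1, hs (left_mem_segment ℝ _ _)⟩
    · have hcr := hs (right_mem_segment ℝ _ _)
      have hcl : D.pt c ∉ D.leftSide C := fun hcl => hc (mem_of_pt_mem_sides hC.1 hcl hcr)
      exact Or.inl ⟨(h.resolve_right fun h => hcl h.2).1, hs (left_mem_segment ℝ _ _)⟩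

end Chains

/-! ### The left-to-right order of the atoms -/

section Atoms

theorem exists_isMaxChain_mem {L : Type*} [PartialOrder L] (x : L) :
    ∃ C : Set L, IsMaxChain (· ≤ ·) C ∧ x ∈ C := by
  obtain ⟨C, hC, hxC⟩ := (IsChain.singleton (r := (· ≤ ·)) (a := x)).exists_maxChain
  exact ⟨C, hC, hxC rfl⟩

variable {L : Type*} [PartialOrder L] [BoundedOrder L] (D : PlanarDiagram L)

/-- The inverse slope (horizontal over vertical displacement) of the segment from the point of `⊥`
to the point of `u`. It is meant for `u ≠ ⊥`, when this segment is not horizontal. -/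
noncomputable def invSlope (u : L) : ℝ :=
  ((D.pt u).1 - (D.pt ⊥).1) / ((D.pt u).2 - (D.pt ⊥).2)

variable {D} {C : Set L} {u v w : L}

theorem atom_eq_of_mem_isChain (hC : IsChain (· ≤ ·) C) (hu : IsAtom u) (hv : IsAtom v)
    (huC : u ∈ C) (hvC : v ∈ C) : u = v :=
  (hC.total huC hvC).elim (fun h => (hv.le_iff_eq hu.1).1 h) fun h => ((hu.le_iff_eq hv.1).1 h).symm

variable [Finite L]

theorem height_bot_lt (hu : IsAtom u) : (D.pt ⊥).2 < (D.pt u).2 :=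
  D.height_strictMono hu.bot_lt

theorem fst_eq_of_mem_atom_edge (hu : IsAtom u) {z : ℝ × ℝ}
    (hz : z ∈ segment ℝ (D.pt ⊥) (D.pt u)) :
    z.1 = (D.pt ⊥).1 + D.invSlope u * (z.2 - (D.pt ⊥).2) :=
  fst_eq_of_mem_segment (height_bot_lt hu) hz

/-- Two edges that leave the bottom point have points above it at a common height. -/
theorem exists_atom_edge_points (hu : IsAtom u) (hv : IsAtom v) :
    ∃ z ∈ openSegment ℝ (D.pt ⊥) (D.pt u), ∃ t ∈ openSegment ℝ (D.pt ⊥) (D.pt v),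
      z.2 = t.2 ∧ (D.pt ⊥).2 < z.2 := by
  obtain ⟨h, h0, h1⟩ := exists_between (lt_min (height_bot_lt (D := D) hu) (height_bot_lt hv))
  have main : ∀ x, IsAtom x → h < (D.pt x).2 →
      ∃ z ∈ openSegment ℝ (D.pt ⊥) (D.pt x), z.2 = h := by
    intro x hx hhx
    obtain ⟨z, hz, hzh⟩ := exists_mem_segment_snd_eq (height_bot_lt hx) h0.le hhx.le
    rw [← insert_endpoints_openSegment] at hz
    rcases hz with rfl | rfl | hz
    · exact absurd hzh h0.ne
    · exact absurd hzh hhx.ne'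
    · exact ⟨z, hz, hzh⟩
  obtain ⟨z, hz, hzh⟩ := main u hu (h1.trans_le (min_le_left _ _))
  obtain ⟨t, ht, hth⟩ := main v hv (h1.trans_le (min_le_right _ _))
  exact ⟨z, hz, t, ht, hzh.trans hth.symm, hzh ▸ h0⟩

theorem invSlope_ne (hu : IsAtom u) (hv : IsAtom v) (huv : u ≠ v) :
    D.invSlope u ≠ D.invSlope v := by
  intro h
  obtain ⟨z, hz, t, ht, hzt, -⟩ := exists_atom_edge_points (D := D) hu hv
  have hz1 := fst_eq_of_mem_atom_edge hu (openSegment_subset_segment ℝ _ _ hz)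
  have ht1 := fst_eq_of_mem_atom_edge hv (openSegment_subset_segment ℝ _ _ ht)
  have : z = t := by
    refine Prod.ext ?_ hzt
    rw [hz1, ht1, h, hzt]
  subst this
  exact Set.disjoint_left.1 (D.edges_disjoint ⊥ u ⊥ v hu.bot_covBy hv.bot_covBy
    fun he => huv (Prod.mk.inj he).2) hz ht

/-- The side of a maximal chain through the atom `v` on which another atom lies can be read off
just above the bottom point, hence from the inverse slopes. -/
theorem atom_side (hC : IsMaxChain (· ≤ ·) C) (hu : IsAtom u) (hv : IsAtom v) (huv : u ≠ v)
    (hvC : v ∈ C) :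
    (D.pt u ∈ D.leftSide C ↔ D.invSlope u < D.invSlope v) ∧
      (D.pt u ∈ D.rightSide C ↔ D.invSlope v < D.invSlope u) := by
  have huC : u ∉ C := fun huC => huv (atom_eq_of_mem_isChain hC.1 hu hv huC hvC)
  obtain ⟨z, hz, t, ht, hzt, hz0⟩ := exists_atom_edge_points (D := D) hu hv
  have hz' := openSegment_subset_segment ℝ _ _ hz
  have ht' := openSegment_subset_segment ℝ _ _ ht
  have hz1 := fst_eq_of_mem_atom_edge hu hz'
  have ht1 := fst_eq_of_mem_atom_edge hv ht'
  have htC : t ∈ D.chainPath C := ⟨⊥, hC.bot_mem, v, hvC, hv.bot_covBy.wcovBy, ht'⟩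
  have hpos : 0 < z.2 - (D.pt ⊥).2 := sub_pos.2 hz0
  rw [← hzt] at ht1
  have hne := invSlope_ne (D := D) hu hv huv
  rcases edge_subset_side (D := D) hC hu.bot_covBy with hs | hs
  · have hul := hs (right_mem_segment ℝ _ _)
    have hlt : D.invSlope u < D.invSlope v := by
      obtain ⟨p, hp, hp2, hp1⟩ := hs hz'
      rw [chainPath_height_injOn hC.1 hp htC (hp2.trans hzt), hz1, ht1] at hp1
      exact lt_of_le_of_ne (le_of_mul_le_mul_right (by linarith) hpos) hne
    exact ⟨iff_of_true hul hlt,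
      iff_of_false (fun h => huC (mem_of_pt_mem_sides hC.1 hul h)) hlt.not_gt⟩
  · have hur := hs (right_mem_segment ℝ _ _)
    have hlt : D.invSlope v < D.invSlope u := by
      obtain ⟨p, hp, hp2, hp1⟩ := hs hz'
      rw [chainPath_height_injOn hC.1 hp htC (hp2.trans hzt), hz1, ht1] at hp1
      exact lt_of_le_of_ne (le_of_mul_le_mul_right (by linarith) hpos) hne.symm
    exact ⟨iff_of_false (fun h => huC (mem_of_pt_mem_sides hC.1 h hur)) hlt.not_gt,
      iff_of_true hur hlt⟩

/-- A maximal chain through the middle one of three atoms separates the other two, so the ways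
from these two up to a common upper bound pass through an element above the middle atom. -/
theorem atom_le_of_invSlope_between (hu : IsAtom u) (hv : IsAtom v) (hw : IsAtom w)
    (huv : D.invSlope u < D.invSlope v) (hvw : D.invSlope v < D.invSlope w) {y : L}
    (huy : u ≤ y) (hwy : w ≤ y) : v ≤ y := by
  obtain ⟨C, hC, hvC⟩ := exists_isMaxChain_mem v
  have huv' : u ≠ v := fun h => huv.ne (h ▸ rfl)
  have hwv' : w ≠ v := fun h => hvw.ne' (h ▸ rfl)
  have hul := (atom_side hC hu hv huv' hvC).1.2 huv
  have hwr := (atom_side hC hw hv hwv' hvC).2.2 hvw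
  have key : ∀ x, IsAtom x → x ≠ v → (∃ z ∈ C, x ≤ z ∧ z ≤ y) → v ≤ y := by
    rintro x hx hxv ⟨z, hzC, hxz, hzy⟩
    rcases hC.1.total hvC hzC with h | h
    · exact h.trans hzy
    · exact absurd ((hv.le_iff_eq hx.1).1 (hxz.trans h)) hxv
  rcases pt_mem_leftSide_or_mem_rightSide (D := D) hC y with hy | hy
  · exact key w hw hwv' (exists_mem_between_of_mem_sides hC hwy (Or.inr ⟨hwr, hy⟩))
  · exact key u hu huv' (exists_mem_between_of_mem_sides hC huy (Or.inl ⟨hul, hy⟩))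

theorem LeftOf.invSlope_lt (hu : IsAtom u) (hv : IsAtom v) (h : D.LeftOf u v) :
    D.invSlope u < D.invSlope v := by
  obtain ⟨huv, -, C, hC, hvC, hl⟩ := h
  exact (atom_side hC hu hv (fun he => huv he.le) hvC).1.1 hl

end Atoms

/-! ### The chain of the joins with the leftmost atom -/

section Joins

variable {L : Type*} [Lattice L] [BoundedOrder L] {n : ℕ} {a : Fin n → L}

theorem isAtom_of_range_eq (ha : Set.range a = {p : L | IsAtom p}) (i : Fin n) : IsAtom (a i) :=
  ha.subset ⟨i, rfl⟩

theorem bot_lt_leftChainElement (ha : Set.range a = {p : L | IsAtom p}) (k : Fin n) :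
    ⊥ < leftChainElement a k :=
  (isAtom_of_range_eq ha k).bot_lt.trans_le le_sup_right

variable [Finite L] {D : PlanarDiagram L}

theorem exists_atom_le_of_ne_bot (ha : Set.range a = {p : L | IsAtom p}) {y : L} (hy : y ≠ ⊥) :
    ∃ i, a i ≤ y := by
  obtain ⟨p, hp, hpy⟩ := (IsAtomic.eq_bot_or_exists_atom_le y).resolve_left hy
  obtain ⟨i, rfl⟩ := ha.superset hp
  exact ⟨i, hpy⟩

/-- The atoms below an element form an interval in the left-to-right order. -/
theorem atom_le_of_between (ha : Set.range a = {p : L | IsAtom p})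
    (hs : StrictMono fun i => D.invSlope (a i)) {i j k : Fin n} (hij : i ≤ j) (hjk : j ≤ k) {y : L}
    (hi : a i ≤ y) (hk : a k ≤ y) : a j ≤ y := by
  rcases hij.eq_or_lt with rfl | hij
  · exact hi
  rcases hjk.eq_or_lt with rfl | hjk
  · exact hk
  have h := isAtom_of_range_eq ha
  exact atom_le_of_invSlope_between (h i) (h j) (h k) (hs hij) (hs hjk) hi hk

theorem atom_le_leftChainElement (ha : Set.range a = {p : L | IsAtom p})
    (hs : StrictMono fun i => D.invSlope (a i)) {i k : Fin n} (hik : i ≤ k) :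
    a i ≤ leftChainElement a k :=
  atom_le_of_between ha hs (Fin.mk_le_of_le_val (Nat.zero_le _)) hik le_sup_left le_sup_right

theorem leftChainElement_monotone (ha : Set.range a = {p : L | IsAtom p})
    (hs : StrictMono fun i => D.invSlope (a i)) : Monotone (leftChainElement a) :=
  fun _ _ hij => sup_le le_sup_left (atom_le_leftChainElement ha hs hij)

theorem leftChainElement_eq_sup (ha : Set.range a = {p : L | IsAtom p})
    (hs : StrictMono fun i => D.invSlope (a i)) (k : Fin n) :
    leftChainElement a k = (Finset.Iic k).sup a := by
  apply le_antisymm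
  · exact sup_le (Finset.le_sup (Finset.mem_Iic.2 (Fin.mk_le_of_le_val (Nat.zero_le _))))
      (Finset.le_sup (Finset.mem_Iic.2 le_rfl))
  · exact Finset.sup_le fun i hi => atom_le_leftChainElement ha hs (Finset.mem_Iic.1 hi)

/-- The elements `y` for which the implication holds form a sublattice. For a meet `y ⊓ z ≠ ⊥`
with all its atoms among the first ones, `y` and `z` cannot both have later atoms, as their atoms
form intervals with a common member and these would share a later atom, too. -/
theorem le_leftChainElement (ha : Set.range a = {p : L | IsAtom p})
    (hs : StrictMono fun i => D.invSlope (a i))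
    (hgen : latticeClosure (insert ⊥ {p : L | IsAtom p}) = Set.univ) (k : Fin n) (y : L)
    (hy : ∀ i, a i ≤ y → i ≤ k) : y ≤ leftChainElement a k := by
  have hy' : y ∈ latticeClosure (insert ⊥ {p : L | IsAtom p}) := hgen ▸ Set.mem_univ y
  induction hy' using latticeClosure_sup_inf_induction with
  | mem p hp =>
    rcases hp with rfl | hp
    · exact bot_le
    · obtain ⟨i, rfl⟩ := ha.superset hp
      exact atom_le_leftChainElement ha hs (hy i le_rfl)
  | sup y _ z _ ihy ihz =>
    exact sup_le (ihy fun i hi => hy i (hi.trans le_sup_left))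
      (ihz fun i hi => hy i (hi.trans le_sup_right))
  | inf y _ z _ ihy ihz =>
    by_cases h1 : ∀ i, a i ≤ y → i ≤ k
    · exact inf_le_left.trans (ihy h1)
    by_cases h2 : ∀ i, a i ≤ z → i ≤ k
    · exact inf_le_right.trans (ihz h2)
    push Not at h1 h2
    obtain ⟨i₁, hi₁, hk₁⟩ := h1
    obtain ⟨i₂, hi₂, hk₂⟩ := h2
    by_cases h0 : y ⊓ z = ⊥
    · exact h0 ▸ bot_le
    obtain ⟨i, hi⟩ := exists_atom_le_of_ne_bot ha h0
    have hik : i ≤ k := hy i hi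
    have him : i ≤ min i₁ i₂ := hik.trans (le_min hk₁.le hk₂.le)
    refine absurd (hy (min i₁ i₂) (le_inf ?_ ?_)) (lt_min hk₁ hk₂).not_ge
    · exact atom_le_of_between ha hs him (min_le_left _ _) (hi.trans inf_le_left) hi₁
    · exact atom_le_of_between ha hs him (min_le_right _ _) (hi.trans inf_le_right) hi₂

/-- The elements above the leftmost atom are the joins of this atom with the atoms. -/
theorem exists_eq_leftChainElement (ha : Set.range a = {p : L | IsAtom p})
    (hs : StrictMono fun i => D.invSlope (a i))
    (hgen : latticeClosure (insert ⊥ {p : L | IsAtom p}) = Set.univ) (h0 : 0 < n) {y : L}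
    (hy : a ⟨0, h0⟩ ≤ y) : ∃ k, leftChainElement a k = y := by
  obtain ⟨k, hk, hmax⟩ := Set.Finite.exists_maximal (s := {i | a i ≤ y}) (Set.toFinite _) ⟨_, hy⟩
  refine ⟨k, le_antisymm (sup_le hy hk) (le_leftChainElement ha hs hgen k y fun i hi => ?_)⟩
  exact (le_total i k).elim id fun h => hmax hi h

theorem leftChainElement_eq_top (ha : Set.range a = {p : L | IsAtom p})
    (hs : StrictMono fun i => D.invSlope (a i))
    (hgen : latticeClosure (insert ⊥ {p : L | IsAtom p}) = Set.univ) {k : Fin n}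
    (hk : (k : ℕ) + 1 = n) : leftChainElement a k = ⊤ :=
  top_le_iff.1 <| le_leftChainElement ha hs hgen k ⊤ fun i _ => Fin.le_def.2 (by omega)

theorem isMaxChain_leftChain (ha : Set.range a = {p : L | IsAtom p})
    (hs : StrictMono fun i => D.invSlope (a i))
    (hgen : latticeClosure (insert ⊥ {p : L | IsAtom p}) = Set.univ) :
    IsMaxChain (· ≤ ·) (insert ⊥ (Set.range (leftChainElement a))) := by
  refine ⟨(leftChainElement_monotone ha hs).isChain_range.insert fun b _ _ => Or.inl bot_le,
    fun t ht hsub => hsub.antisymm fun y hy => ?_⟩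
  by_cases hy0 : y = ⊥
  · exact Or.inl hy0
  obtain ⟨i, hi⟩ := exists_atom_le_of_ne_bot ha hy0
  have h0 : a ⟨0, i.pos⟩ ∈ t :=
    hsub (Or.inr ⟨⟨0, i.pos⟩, sup_idem _⟩)
  rcases ht.total h0 hy with h | h
  · exact Or.inr (exists_eq_leftChainElement ha hs hgen i.pos h)
  · have h' := ((isAtom_of_range_eq ha _).le_iff_eq hy0).1 h
    exact Or.inr (exists_eq_leftChainElement ha hs hgen i.pos h'.ge)

/-! ### The boundaries -/

/-- An ascending path from an atom to an element strictly on the left of the chain would meet the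
chain, and all elements above the leftmost atom belong to the chain. -/
theorem pt_mem_rightSide_leftChain (ha : Set.range a = {p : L | IsAtom p})
    (hs : StrictMono fun i => D.invSlope (a i))
    (hgen : latticeClosure (insert ⊥ {p : L | IsAtom p}) = Set.univ) (y : L) :
    D.pt y ∈ D.rightSide (insert ⊥ (Set.range (leftChainElement a))) := by
  have hmax := isMaxChain_leftChain ha hs hgen
  by_contra hyr
  have hyC : y ∉ insert ⊥ (Set.range (leftChainElement a)) := fun h =>
    hyr (D.chainPath_subset_rightSide _ (D.pt_mem_chainPath h))
  have hyl := (pt_mem_leftSide_or_mem_rightSide (D := D) hmax y).resolve_right hyr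
  obtain ⟨i, hi⟩ := exists_atom_le_of_ne_bot ha fun h => hyC (Or.inl h)
  have h0C : a ⟨0, i.pos⟩ ∈ insert ⊥ (Set.range (leftChainElement a)) :=
    Or.inr ⟨⟨0, i.pos⟩, sup_idem _⟩
  have hir : D.pt (a i) ∈ D.rightSide (insert ⊥ (Set.range (leftChainElement a))) := by
    have h0i : (⟨0, i.pos⟩ : Fin n) ≤ i := Fin.mk_le_of_le_val (Nat.zero_le _)
    rcases h0i.eq_or_lt with h | h
    · rw [← h]
      exact D.chainPath_subset_rightSide _ (D.pt_mem_chainPath h0C)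
    · have hlt := hs h
      exact (atom_side hmax (isAtom_of_range_eq ha i) (isAtom_of_range_eq ha _)
        (fun he => hlt.ne' (congrArg D.invSlope he)) h0C).2.2 hlt
  obtain ⟨z, hzC, hiz, hzy⟩ := exists_mem_between_of_mem_sides hmax hi (Or.inr ⟨hir, hyl⟩)
  rcases hzC with rfl | ⟨k, rfl⟩
  · exact (isAtom_of_range_eq ha i).1 (le_bot_iff.1 hiz)
  · exact hyC (Or.inr (exists_eq_leftChainElement ha hs hgen i.pos (le_sup_left.trans hzy)))

theorem leftBoundary_eq_leftChain (ha : Set.range a = {p : L | IsAtom p})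
    (hs : StrictMono fun i => D.invSlope (a i))
    (hgen : latticeClosure (insert ⊥ {p : L | IsAtom p}) = Set.univ) :
    insert ⊥ (Set.range (leftChainElement a)) = D.leftBoundary := by
  have hmax := isMaxChain_leftChain ha hs hgen
  have hright := pt_mem_rightSide_leftChain ha hs hgen
  apply Set.Subset.antisymm
  · intro c hc C hC
    obtain ⟨p, hp, hpc⟩ := exists_mem_chainPath (D := D) hC
      (D.height_strictMono.monotone (bot_le : ⊥ ≤ c))
      (D.height_strictMono.monotone (le_top : c ≤ ⊤))
    -- All edges, not only the vertices, are on or to the right of the left chain.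
    have hpr : p ∈ D.rightSide (insert ⊥ (Set.range (leftChainElement a))) := by
      obtain ⟨x, hx, y, hy, hxy, hpxy⟩ := hp
      rcases hxy.covBy_or_eq with hxy | rfl
      · rcases edge_subset_side (D := D) hmax hxy with hs' | hs'
        · exact D.chainPath_subset_rightSide _
            ⟨x, mem_of_pt_mem_sides hmax.1 (hs' (left_mem_segment ℝ _ _)) (hright x),
              y, mem_of_pt_mem_sides hmax.1 (hs' (right_mem_segment ℝ _ _)) (hright y),
              hxy.wcovBy, hpxy⟩
        · exact hs' hpxy
      · rw [segment_same] at hpxy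
        rw [Set.mem_singleton_iff.1 hpxy]
        exact hright x
    obtain ⟨q, hq, hqp, hle⟩ := hpr
    rw [chainPath_height_injOn hmax.1 hq (D.pt_mem_chainPath hc) (hqp.trans hpc)] at hle
    exact ⟨p, hp, hpc, hle⟩
  · exact fun x hx => mem_of_pt_mem_sides hmax.1 (hx _ hmax) (hright x)

theorem exists_atom_enumeration (D : PlanarDiagram L) (hn : {p : L | IsAtom p}.ncard = n) :
    ∃ a : Fin n → L, Set.range a = {p : L | IsAtom p} ∧ StrictMono fun i => D.invSlope (a i) := by
  classical
  have hfin : {p : L | IsAtom p}.Finite := Set.toFinite _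
  have hcard : (hfin.toFinset.image D.invSlope).card = n := by
    rw [Finset.card_image_of_injOn, ← Set.ncard_eq_toFinset_card _ hfin, hn]
    intro u hu v hv h
    by_contra hne
    exact invSlope_ne (hfin.mem_toFinset.1 hu) (hfin.mem_toFinset.1 hv) hne h
  set e := (hfin.toFinset.image D.invSlope).orderEmbOfFin hcard with he
  have hmem : ∀ i, ∃ p, IsAtom p ∧ D.invSlope p = e i := fun i => by
    obtain ⟨p, hp, hpi⟩ := Finset.mem_image.1
      (Finset.orderEmbOfFin_mem (hfin.toFinset.image D.invSlope) hcard i)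
    exact ⟨p, hfin.mem_toFinset.1 hp, hpi⟩
  choose a ha hae using hmem
  refine ⟨a, Set.Subset.antisymm (Set.range_subset_iff.2 ha) fun p hp => ?_, fun i j hij => ?_⟩
  · have hp' : D.invSlope p ∈ Set.range e := by
      rw [he, Finset.range_orderEmbOfFin]
      exact Finset.mem_coe.2 (Finset.mem_image_of_mem _ (hfin.mem_toFinset.2 hp))
    obtain ⟨i, hi⟩ := hp'
    refine ⟨i, ?_⟩
    by_contra hne
    exact invSlope_ne (ha i) hp hne ((hae i).trans hi)
  · simpa only [hae] using e.strictMono hij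

theorem ncard_leftBoundary_le (D : PlanarDiagram L) (hn : {p : L | IsAtom p}.ncard = n)
    (hgen : latticeClosure (insert ⊥ {p : L | IsAtom p}) = Set.univ) :
    D.leftBoundary.ncard ≤ n + 1 := by
  obtain ⟨a, ha, hs⟩ := D.exists_atom_enumeration hn
  rw [← leftBoundary_eq_leftChain ha hs hgen]
  refine (Set.ncard_insert_le _ _).trans (Nat.add_le_add_right ?_ 1)
  rw [← Set.image_univ]
  refine (Set.ncard_image_le (Set.toFinite _)).trans ?_
  rw [Set.ncard_univ, Nat.card_eq_fintype_card, Fintype.card_fin]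

end Joins

/-! ### Reflection in a vertical line -/

section Mirror

/-- The reflection of the plane in the vertical axis. -/
def reflection : (ℝ × ℝ) ≃ₗ[ℝ] ℝ × ℝ :=
  (LinearEquiv.neg ℝ).prodCongr (LinearEquiv.refl ℝ ℝ)

theorem image_reflection_openSegment (p q : ℝ × ℝ) :
    reflection '' openSegment ℝ p q = openSegment ℝ (reflection p) (reflection q) :=
  image_openSegment ℝ reflection.toLinearMap.toAffineMap p q

theorem image_reflection_segment (p q : ℝ × ℝ) :
    reflection '' segment ℝ p q = segment ℝ (reflection p) (reflection q) :=
  image_segment ℝ reflection.toLinearMap.toAffineMap p q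

variable {L : Type*} [PartialOrder L] (D : PlanarDiagram L)

/-- The mirror image of a diagram: left and right are exchanged. -/
def mirror : PlanarDiagram L where
  pt x := reflection (D.pt x)
  pt_injective := reflection.injective.comp D.pt_injective
  height_lt := D.height_lt
  pt_notMem_edge a b c hab := by
    rw [← image_reflection_openSegment, reflection.injective.mem_set_image]
    exact D.pt_notMem_edge a b c hab
  edges_disjoint a b c d hab hcd h := by
    rw [← image_reflection_openSegment, ← image_reflection_openSegment,
      Set.disjoint_image_iff reflection.injective]
    exact D.edges_disjoint a b c d hab hcd h

theorem reflection_mem_chainPath_mirror {C : Set L} {p : ℝ × ℝ} (hp : p ∈ D.chainPath C) :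
    reflection p ∈ D.mirror.chainPath C := by
  obtain ⟨a, ha, b, hb, hab, hp⟩ := hp
  refine ⟨a, ha, b, hb, hab, ?_⟩
  exact (image_reflection_segment (D.pt a) (D.pt b)).subset ⟨p, hp, rfl⟩

theorem rightBoundary_subset_leftBoundary_mirror : D.rightBoundary ⊆ D.mirror.leftBoundary := by
  intro x hx C hC
  obtain ⟨p, hp, hp2, hp1⟩ := hx C hC
  exact ⟨reflection p, D.reflection_mem_chainPath_mirror hp, hp2, neg_le_neg hp1⟩

end Mirror

end PlanarDiagram

theorem theorem1 {L : Type*} [Lattice L] [Finite L] [BoundedOrder L]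
    (D : PlanarDiagram L) (n : ℕ) (hn : {p : L | IsAtom p}.ncard = n)
    (hgen : latticeClosure (insert ⊥ {p : L | IsAtom p}) = Set.univ) :
    (∀ a : Fin n → L, Set.range a = {p : L | IsAtom p} →
      (∀ i j : Fin n, i < j → D.LeftOf (a i) (a j)) →
        (∀ k : Fin n, leftChainElement a k = (Finset.Iic k).sup a) ∧
        (∀ k : Fin n, ⊥ < leftChainElement a k) ∧
        Monotone (leftChainElement a) ∧
        (∀ k : Fin n, (k : ℕ) + 1 = n → leftChainElement a k = ⊤) ∧
        IsMaxChain (· ≤ ·) (insert ⊥ (Set.range (leftChainElement a))) ∧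
        insert ⊥ (Set.range (leftChainElement a)) = D.leftBoundary) ∧
    D.leftBoundary.ncard ≤ n + 1 ∧
    D.rightBoundary.ncard ≤ n + 1 := by
  refine ⟨fun a ha hleft => ?_, D.ncard_leftBoundary_le hn hgen, ?_⟩
  · have hs : StrictMono fun i => D.invSlope (a i) := fun i j hij =>
      (hleft i j hij).invSlope_lt (PlanarDiagram.isAtom_of_range_eq ha i)
        (PlanarDiagram.isAtom_of_range_eq ha j)
    exact ⟨PlanarDiagram.leftChainElement_eq_sup ha hs,
      PlanarDiagram.bot_lt_leftChainElement ha,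
      PlanarDiagram.leftChainElement_monotone ha hs,
      fun _ => PlanarDiagram.leftChainElement_eq_top ha hs hgen,
      PlanarDiagram.isMaxChain_leftChain ha hs hgen,
      PlanarDiagram.leftBoundary_eq_leftChain ha hs hgen⟩
  · exact (Set.ncard_le_ncard D.rightBoundary_subset_leftBoundary_mirror (Set.toFinite _)).trans
      (D.mirror.ncard_leftBoundary_le hn hgen)
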